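/- Let $d\ge 1$. There is a constant $C>0$ depending only on $d$ with the following property. Let $\mu$ be a Borel probability measure on $\mathbb{R}^d$ with $$M:=\Big(\int_{\mathbb{R}^d}\|y\|_6^6\,\mu(dy)\Big)^{1/6}<\infty ,\qquad \|y\|_6^6=\sum_{i=1}^d|y_i|^6,$$ put $\sigma_i:=\big(\int_{\mathbb{R}^d}y_i^6\,\mu(dy)\big)^{1/6}$, and assume $\sigma_1\ge\dots\ge\sigma_d>0$. For $N\ge1$ let $\mu_N=\frac1N\sum_{i=1}^N\delta_{Y_i}$ be the empirical measure of i.i.d. random vectors $Y_1,\dots,Y_N$ with law $\mu$, and let $$W_2(\mu,\nu)=\inf_{\pi}\Big(\int\|x-y\|^2\,\pi(dx,dy)\Big)^{1/2},$$ where $\|\cdot\|$ is the Euclidean norm and $\pi$ ranges over the Borel probability measures on $\mathbb{R}^d\times\mathbb{R}^d$ with marginals $\mu$ and $\nu$. Then there is $N_0$, depending on $\mu$, such that for all $N\ge N_0$ $$\mathbb{E}\big[W_2^2(\mu_N,\mu)\big]\le C M^2\times\begin{cases}N^{-1/2}\log(1+N), & d\le 4,\\[2pt] N^{-1/2}+\Big(\dfrac{N}{\prod_{i=1}^d(\sigma_i/\sigma_1)}\Big)^{-2/d},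 & d>4.\end{cases}$$ -/

import Mathlib

open MeasureTheory ProbabilityTheory Filter
open scoped ENNReal

noncomputable section

/-- The couplings `Π_{μ,ν}`: Borel probability measures on `ℝ^d × ℝ^d` with marginals `μ`, `ν`. -/
def couplings {d : ℕ} (μ ν : Measure (EuclideanSpace ℝ (Fin d))) :
    Set (Measure (EuclideanSpace ℝ (Fin d) × EuclideanSpace ℝ (Fin d))) :=
  {π | IsProbabilityMeasure π ∧ π.map Prod.fst = μ ∧ π.map Prod.snd = ν}

/-- The `W₂` distance for the Euclidean norm, with values in `[0, ∞]`. -/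
def W2 {d : ℕ} (μ ν : Measure (EuclideanSpace ℝ (Fin d))) : ℝ≥0∞ :=
  ⨅ π ∈ couplings μ ν, (∫⁻ p, ‖p.1 - p.2‖ₑ ^ 2 ∂π) ^ (1 / 2 : ℝ)

/-- The empirical measure `(1/N) ∑ δ_{x_i}` of the points `x_0, …, x_{N-1}`. -/
def empiricalMeasure {d N : ℕ} (x : Fin N → EuclideanSpace ℝ (Fin d)) :
    Measure (EuclideanSpace ℝ (Fin d)) :=
  (N : ℝ≥0∞)⁻¹ • ∑ i, Measure.dirac (x i)

/-- `‖y‖₆⁶`, the sixth power of the `ℓ⁶` norm. -/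
def l6NormPow {d : ℕ} (y : EuclideanSpace ℝ (Fin d)) : ℝ := ∑ i, |y i| ^ 6

/-- `M = (∫ ‖y‖₆⁶ dμ)^{1/6}`. -/
def momentM {d : ℕ} (μ : Measure (EuclideanSpace ℝ (Fin d))) : ℝ :=
  (∫ y, l6NormPow y ∂μ) ^ (1 / 6 : ℝ)

/-- `σ_i = (∫ y_i⁶ dμ)^{1/6}`. -/
def sigma6 {d : ℕ} (μ : Measure (EuclideanSpace ℝ (Fin d))) (i : Fin d) : ℝ :=
  (∫ y, y i ^ 6 ∂μ) ^ (1 / 6 : ℝ)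

/-- The convergence rate; `σ 0` is the first (largest) scale. -/
def w2Rate {d : ℕ} [NeZero d] (σ : Fin d → ℝ) (N : ℕ) : ℝ :=
  if d ≤ 4 then (N : ℝ) ^ (-(1 / 2) : ℝ) * Real.log (1 + N)
  else (N : ℝ) ^ (-(1 / 2) : ℝ) + ((N : ℝ) / ∏ i, (σ i / σ 0)) ^ (-(2 / (d : ℝ)))

end

/-! The proof is a dyadic matching argument adapted to the anisotropy of `μ`. Rescale coordinate `i`
by `σ_i` and cut space into shells, the `n`-th one lying in the box `|y_i| ≤ 2^n σ_i`. By the sixth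
moments it has mass at most of order `64^{-n}`. Cut each shell into cubes of side `2^n ε`. As long
as `ε ≤ min σ_i`, a shell meets at most `4^d ∏ σ_i / ε^d` of them, whatever `n` is
(`card_cubes_le`); this count is what brings `∏ σ_i` into the rate.

Let `ε, 2ε, …, 2^K ε = δ = min σ_i` be the scales. Match as much mass of `μ_N` and `μ` as possible
inside the finest cells, then match what is left over in the next coarser cells, and so on; at the
end everything left is matched arbitrarily. The mass left over in a cell `A` is `|μ_N(A) - μ(A)|`,
of mean at most `√(μ(A)/N)`, and it moves by at most the diameter of the next cell. Cauchy–Schwarz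
over the cubes of a shell gives `8^{-n}`, which beats the squared diameter factor `4^n`. So scale `e
= 2^k ε` costs a constant times `e^2 √(∏ σ_i / (e^d N))` (`lintegral_W2_sq_le`).

If `d ≤ 4`, each scale below `δ` costs at most `M^2 N^{-1/2}` up to a constant, and about `log N`
scales suffice. If `d > 4`, the costs decay geometrically away from the finest scale, chosen near `E
= (∏ σ_i / N)^{1/d}`, and sum to order `E^2`. The last, arbitrary matching costs `N^{-1/2}` with a
factor depending on `μ`; it is absorbed by taking `N` large, by `log N` if `d ≤ 4` and by `N^{1/2 -
2/d}` if `d > 4`. -/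

/-! ### Greedy matching along nested partitions. -/

section Coupling

variable {X ι : Type*} [MeasurableSpace X]

/-- The share of the mass `a` of a cell that is matched with the mass `b`, plus the share that is
left over, is everything. -/
lemma matched_add_residual {a b : ℝ≥0∞} (ha : a ≠ 0) (ha' : a ≠ ∞) (hb' : b ≠ ∞) :
    min a b / (a * b) * b + (a - b) / a = 1 := by
  rcases eq_or_ne b 0 with rfl | hb
  · simp [ENNReal.div_self ha ha']
  have h1 : min a b / (a * b) * b = min a b / a := by
    rw [div_eq_mul_inv, ENNReal.mul_inv (Or.inl ha) (Or.inl ha'), div_eq_mul_inv, mul_assoc,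
      mul_assoc, ENNReal.inv_mul_cancel hb hb', mul_one]
  rw [h1, ← ENNReal.add_div]
  have h2 : min a b + (a - b) = a := by
    rcases le_total a b with h | h
    · simp [min_eq_left h, tsub_eq_zero_of_le h]
    · rw [min_eq_right h, add_tsub_cancel_of_le h]
  rw [h2, ENNReal.div_self ha ha']

lemma sum_restrict_preimage_singleton [MeasurableSpace ι] [Countable ι]
    [MeasurableSingletonClass ι] {q : X → ι} (hq : Measurable q) (μ : Measure X) :
    Measure.sum (fun i => μ.restrict (q ⁻¹' {i})) = μ := by
  rw [← Measure.restrict_iUnion]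
  · rw [show (⋃ i, q ⁻¹' {i}) = Set.univ from by ext x; simp, Measure.restrict_univ]
  · intro i j hij
    exact Disjoint.preimage _ (by simpa using hij)
  · exact fun i => hq (measurableSet_singleton i)

lemma lintegral_comp_eq_tsum_preimage [MeasurableSpace ι] [Countable ι]
    [MeasurableSingletonClass ι] {q : X → ι} (hq : Measurable q) (μ : Measure X)
    (f : ι → ℝ≥0∞) : ∫⁻ x, f (q x) ∂μ = ∑' i, f i * μ (q ⁻¹' {i}) := by
  rw [← lintegral_map (measurable_of_countable f) hq, lintegral_countable']
  exact tsum_congr fun i => by rw [Measure.map_apply hq (measurableSet_singleton i)]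

/-- Matching as much mass as possible inside each cell of a countable partition, given by the
fibres of `q`. -/
lemma exists_partial_coupling [MeasurableSpace ι] [Countable ι] [MeasurableSingletonClass ι]
    {q : X → ι} (hq : Measurable q) (μ ν : Measure X) [IsFiniteMeasure μ] [IsFiniteMeasure ν] :
    ∃ (γ : Measure (X × X)) (μ' ν' : Measure X),
      γ.map Prod.fst + μ' = μ ∧ γ.map Prod.snd + ν' = ν ∧ (∀ᵐ p ∂γ, q p.1 = q p.2) ∧
      (∀ i, μ' (q ⁻¹' {i}) = μ (q ⁻¹' {i}) - ν (q ⁻¹' {i})) ∧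
      (∀ i, ν' (q ⁻¹' {i}) = ν (q ⁻¹' {i}) - μ (q ⁻¹' {i})) := by
  have hA : ∀ i, MeasurableSet (q ⁻¹' {i}) := fun i => hq (measurableSet_singleton i)
  have key : ∀ (μ ν : Measure X) [IsFiniteMeasure μ] [IsFiniteMeasure ν],
      Measure.sum (fun i => (min (μ (q ⁻¹' {i})) (ν (q ⁻¹' {i})) /
          (μ (q ⁻¹' {i}) * ν (q ⁻¹' {i})) * ν (q ⁻¹' {i})) • μ.restrict (q ⁻¹' {i})) +
        Measure.sum (fun i => ((μ (q ⁻¹' {i}) - ν (q ⁻¹' {i})) / μ (q ⁻¹' {i})) •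
          μ.restrict (q ⁻¹' {i})) = μ := by
    intro μ ν _ _
    rw [Measure.sum_add_sum]
    conv_rhs => rw [← sum_restrict_preimage_singleton hq μ]
    congr 1
    ext1 i
    -- On a null cell the quotients by zero are harmless: they multiply the zero measure.
    rcases eq_or_ne (μ (q ⁻¹' {i})) 0 with h | h
    · simp [Measure.restrict_eq_zero.2 h]
    · rw [← add_smul, matched_add_residual h (measure_ne_top _ _) (measure_ne_top _ _), one_smul]
  have res : ∀ (μ ν : Measure X) [IsFiniteMeasure μ] [IsFiniteMeasure ν] (j : ι),
      Measure.sum (fun i => ((μ (q ⁻¹' {i}) - ν (q ⁻¹' {i})) / μ (q ⁻¹' {i})) •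
          μ.restrict (q ⁻¹' {i})) (q ⁻¹' {j}) = μ (q ⁻¹' {j}) - ν (q ⁻¹' {j}) := by
    intro μ ν _ _ j
    rw [Measure.sum_apply _ (hA j), tsum_eq_single j]
    · rw [Measure.smul_apply, Measure.restrict_apply (hA j), Set.inter_self, smul_eq_mul]
      rcases eq_or_ne (μ (q ⁻¹' {j})) 0 with h | h
      · simp [h]
      · rw [ENNReal.div_mul_cancel h (measure_ne_top _ _)]
    · intro i hij
      rw [Measure.smul_apply, Measure.restrict_apply (hA j)]
      have : q ⁻¹' {j} ∩ q ⁻¹' {i} = ∅ := by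
        ext x; simp only [Set.mem_inter_iff, Set.mem_preimage, Set.mem_singleton_iff]
        constructor
        · rintro ⟨rfl, h⟩; exact hij h.symm
        · simp
      simp [this]
  refine ⟨Measure.sum (fun i => (min (μ (q ⁻¹' {i})) (ν (q ⁻¹' {i})) /
      (μ (q ⁻¹' {i}) * ν (q ⁻¹' {i}))) • (μ.restrict (q ⁻¹' {i})).prod (ν.restrict (q ⁻¹' {i}))),
    Measure.sum (fun i => ((μ (q ⁻¹' {i}) - ν (q ⁻¹' {i})) / μ (q ⁻¹' {i})) •
          μ.restrict (q ⁻¹' {i})),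
    Measure.sum (fun i => ((ν (q ⁻¹' {i}) - μ (q ⁻¹' {i})) / ν (q ⁻¹' {i})) •
          ν.restrict (q ⁻¹' {i})), ?_, ?_, ?_, res μ ν, res ν μ⟩
  · refine Eq.trans ?_ (key μ ν)
    rw [Measure.map_sum measurable_fst.aemeasurable]
    congr 2
    ext1 i
    rw [Measure.map_smul, Measure.map_fst_prod, Measure.restrict_apply_univ, smul_smul]
  · refine Eq.trans ?_ (key ν μ)
    rw [Measure.map_sum measurable_snd.aemeasurable]
    congr 2
    ext1 i
    rw [Measure.map_smul, Measure.map_snd_prod, Measure.restrict_apply_univ, smul_smul, min_comm,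
      mul_comm (μ _)]
  · have hm : MeasurableSet {p : X × X | q p.1 = q p.2} :=
      measurableSet_eq_fun (hq.comp measurable_fst) (hq.comp measurable_snd)
    rw [Measure.ae_sum_iff' hm]
    intro i
    refine Measure.ae_smul_measure ?_ _
    rw [Measure.prod_restrict]
    filter_upwards [ae_restrict_mem ((hA i).prod (hA i))] with p hp
    exact hp.1.trans hp.2.symm

/-- Iterated matching along a sequence of coarser and coarser countable partitions, given by the
fibres of `q 0, q 1, …`. The mass matched at step `k + 1` is what is left over at step `k`. -/
lemma exists_multiscale_coupling [MeasurableSpace ι] [Countable ι] [MeasurableSingletonClass ι]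
    {q : ℕ → X → ι} (hq : ∀ k, Measurable (q k))
    (hnest : ∀ k x y, q k x = q k y → q (k + 1) x = q (k + 1) y)
    {c : X × X → ℝ≥0∞} {b : X → ℝ≥0∞} (hb : Measurable b) {β : ℕ → ι → ℝ≥0∞}
    (hc0 : ∀ x y, q 0 x = q 0 y → c (x, y) ≤ b x + b y)
    (hc : ∀ k x y, q (k + 1) x = q (k + 1) y → c (x, y) ≤ β k (q k x) + β k (q k y))
    (μ ν : Measure X) [IsFiniteMeasure μ] [IsFiniteMeasure ν] (K : ℕ) :
    ∃ (γ : Measure (X × X)) (μ' ν' : Measure X),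
      γ.map Prod.fst + μ' = μ ∧ γ.map Prod.snd + ν' = ν ∧ (∀ᵐ p ∂γ, q K p.1 = q K p.2) ∧
      (∀ i, μ' (q K ⁻¹' {i}) = μ (q K ⁻¹' {i}) - ν (q K ⁻¹' {i})) ∧
      (∀ i, ν' (q K ⁻¹' {i}) = ν (q K ⁻¹' {i}) - μ (q K ⁻¹' {i})) ∧
      ∫⁻ p, c p ∂γ ≤ ∫⁻ x, b x ∂μ + ∫⁻ x, b x ∂ν + ∑ k ∈ Finset.range K,
        ∑' i, β k i * ((μ (q k ⁻¹' {i}) - ν (q k ⁻¹' {i})) +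
          (ν (q k ⁻¹' {i}) - μ (q k ⁻¹' {i}))) := by
  have split : ∀ (γ : Measure (X × X)) (f : X → ℝ≥0∞), Measurable f →
      ∫⁻ p, (f p.1 + f p.2) ∂γ = ∫⁻ x, f x ∂(γ.map Prod.fst) + ∫⁻ x, f x ∂(γ.map Prod.snd) := by
    intro γ f hf
    have hf' : Measurable fun p : X × X => f p.1 := hf.comp measurable_fst
    rw [lintegral_add_left hf', lintegral_map hf measurable_fst,
      lintegral_map hf measurable_snd]
  induction K with
  | zero =>
    obtain ⟨γ, μ', ν', h1, h2, h3, h4, h5⟩ := exists_partial_coupling (hq 0) μ ν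
    refine ⟨γ, μ', ν', h1, h2, h3, h4, h5, ?_⟩
    calc ∫⁻ p, c p ∂γ ≤ ∫⁻ p, (b p.1 + b p.2) ∂γ :=
          lintegral_mono_ae (h3.mono fun p hp => hc0 _ _ hp)
      _ = _ := split γ b hb
      _ ≤ ∫⁻ x, b x ∂μ + ∫⁻ x, b x ∂ν := by
          gcongr
          · exact h1 ▸ Measure.le_add_right le_rfl
          · exact h2 ▸ Measure.le_add_right le_rfl
      _ = _ := by simp
  | succ K ih =>
    obtain ⟨γ, μ₁, ν₁, h1, h2, h3, h4, h5, h6⟩ := ih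
    have hμ₁ : μ₁ ≤ μ := h1 ▸ Measure.le_add_left le_rfl
    have hν₁ : ν₁ ≤ ν := h2 ▸ Measure.le_add_left le_rfl
    have : IsFiniteMeasure μ₁ := isFiniteMeasure_of_le _ hμ₁
    have : IsFiniteMeasure ν₁ := isFiniteMeasure_of_le _ hν₁
    obtain ⟨γ', μ', ν', g1, g2, g3, g4, g5⟩ := exists_partial_coupling (hq (K + 1)) μ₁ ν₁
    have hA : ∀ i, MeasurableSet (q (K + 1) ⁻¹' {i}) :=
      fun i => hq _ (measurableSet_singleton i)
    -- Pairs already matched share a fine cell, hence a coarse one. The two marginals of `γ` thus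
    -- agree on coarse cells and cancel, so the new leftovers are again truncated differences of `μ`
    -- and `ν` themselves.
    have hsame : ∀ i, γ.map Prod.fst (q (K + 1) ⁻¹' {i}) =
        γ.map Prod.snd (q (K + 1) ⁻¹' {i}) := by
      intro i
      rw [Measure.map_apply measurable_fst (hA i), Measure.map_apply measurable_snd (hA i)]
      refine measure_congr ?_
      filter_upwards [h3] with p hp
      have := hnest K _ _ hp
      refine propext ?_
      change q (K + 1) p.1 = i ↔ q (K + 1) p.2 = i
      rw [this]
    have hfin : ∀ i, γ.map Prod.snd (q (K + 1) ⁻¹' {i}) ≠ ∞ := fun i =>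
      ne_top_of_le_ne_top (measure_ne_top ν (q (K + 1) ⁻¹' {i}))
        ((h2 ▸ Measure.le_add_right le_rfl : γ.map Prod.snd ≤ ν) _)
    have e1 : ∀ i, μ (q (K + 1) ⁻¹' {i}) =
        γ.map Prod.snd (q (K + 1) ⁻¹' {i}) + μ₁ (q (K + 1) ⁻¹' {i}) := fun i => by
      rw [← hsame, ← Measure.add_apply, h1]
    have e2 : ∀ i, ν (q (K + 1) ⁻¹' {i}) =
        γ.map Prod.snd (q (K + 1) ⁻¹' {i}) + ν₁ (q (K + 1) ⁻¹' {i}) := fun i => by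
      rw [← Measure.add_apply, h2]
    refine ⟨γ + γ', μ', ν', ?_, ?_, ?_, ?_, ?_, ?_⟩
    · rw [Measure.map_add _ _ measurable_fst, add_assoc, g1, h1]
    · rw [Measure.map_add _ _ measurable_snd, add_assoc, g2, h2]
    · rw [ae_add_measure_iff]
      exact ⟨h3.mono fun p hp => hnest K _ _ hp, g3⟩
    · intro i
      rw [g4, e1, e2, ENNReal.add_sub_add_eq_sub_left (hfin i)]
    · intro i
      rw [g5, e1, e2, ENNReal.add_sub_add_eq_sub_left (hfin i)]
    · rw [lintegral_add_measure, Finset.sum_range_succ, ← add_assoc]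
      refine add_le_add h6 ?_
      -- The cost is charged to the finer cells because `γ'` has marginals below the leftovers of
      -- step `K`, whose masses are known on exactly those cells.
      calc ∫⁻ p, c p ∂γ' ≤ ∫⁻ p, (β K (q K p.1) + β K (q K p.2)) ∂γ' :=
            lintegral_mono_ae (g3.mono fun p hp => hc K _ _ hp)
        _ = _ := split γ' (fun x => β K (q K x)) ((measurable_of_countable _).comp (hq K))
        _ ≤ ∫⁻ x, β K (q K x) ∂μ₁ + ∫⁻ x, β K (q K x) ∂ν₁ := by
            gcongr
            · exact g1 ▸ Measure.le_add_right le_rfl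
            · exact g2 ▸ Measure.le_add_right le_rfl
        _ = _ := by
            rw [lintegral_comp_eq_tsum_preimage (hq K), lintegral_comp_eq_tsum_preimage (hq K),
              ← ENNReal.tsum_add]
            exact tsum_congr fun i => by rw [h4, h5, mul_add]

/-- When the coarsest partition is trivial, iterated matching couples two probability measures. -/
lemma exists_coupling_of_multiscale [MeasurableSpace ι] [Countable ι]
    [MeasurableSingletonClass ι]
    {q : ℕ → X → ι} (hq : ∀ k, Measurable (q k))
    (hnest : ∀ k x y, q k x = q k y → q (k + 1) x = q (k + 1) y)
    {c : X × X → ℝ≥0∞} {b : X → ℝ≥0∞} (hb : Measurable b) {β : ℕ → ι → ℝ≥0∞}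
    (hc0 : ∀ x y, q 0 x = q 0 y → c (x, y) ≤ b x + b y)
    (hc : ∀ k x y, q (k + 1) x = q (k + 1) y → c (x, y) ≤ β k (q k x) + β k (q k y))
    (μ ν : Measure X) [IsProbabilityMeasure μ] [IsProbabilityMeasure ν] {K : ℕ} {i₀ : ι}
    (hK : ∀ x, q K x = i₀) :
    ∃ γ : Measure (X × X), γ.map Prod.fst = μ ∧ γ.map Prod.snd = ν ∧
      ∫⁻ p, c p ∂γ ≤ ∫⁻ x, b x ∂μ + ∫⁻ x, b x ∂ν + ∑ k ∈ Finset.range K,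
        ∑' i, β k i * ((μ (q k ⁻¹' {i}) - ν (q k ⁻¹' {i})) +
          (ν (q k ⁻¹' {i}) - μ (q k ⁻¹' {i}))) := by
  obtain ⟨γ, μ', ν', h1, h2, -, h4, h5, h6⟩ :=
    exists_multiscale_coupling hq hnest hb hc0 hc μ ν K
  have hu : q K ⁻¹' {i₀} = Set.univ := by ext x; simp [hK]
  have hμ' : μ' = 0 := by
    have := h4 i₀
    rwa [hu, measure_univ (μ := μ), measure_univ (μ := ν), tsub_self,
      Measure.measure_univ_eq_zero] at this
  have hν' : ν' = 0 := by
    have := h5 i₀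
    rwa [hu, measure_univ (μ := μ), measure_univ (μ := ν), tsub_self,
      Measure.measure_univ_eq_zero] at this
  exact ⟨γ, by rw [← h1, hμ', add_zero], by rw [← h2, hν', add_zero], h6⟩

end Coupling

/-! ### Fluctuations of the empirical measure. -/

section Empirical

lemma ENNReal.ofReal_sub_add_ofReal_sub {a b : ℝ} (ha : 0 ≤ a) (hb : 0 ≤ b) :
    (ENNReal.ofReal a - ENNReal.ofReal b) + (ENNReal.ofReal b - ENNReal.ofReal a) =
      ENNReal.ofReal |a - b| := by
  rw [← ENNReal.ofReal_sub _ hb, ← ENNReal.ofReal_sub _ ha]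
  rcases le_total a b with h | h
  · rw [ENNReal.ofReal_of_nonpos (sub_nonpos.2 h), abs_of_nonpos (sub_nonpos.2 h), zero_add,
      neg_sub]
  · rw [ENNReal.ofReal_of_nonpos (sub_nonpos.2 h), abs_of_nonneg (sub_nonneg.2 h), add_zero]

variable {d N : ℕ}

lemma empiricalMeasure_apply (x : Fin N → EuclideanSpace ℝ (Fin d))
    {A : Set (EuclideanSpace ℝ (Fin d))} (hA : MeasurableSet A) :
    empiricalMeasure x A =
      ENNReal.ofReal ((N : ℝ)⁻¹ * ∑ i, A.indicator (fun _ => (1 : ℝ)) (x i)) := by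
  rcases Nat.eq_zero_or_pos N with rfl | hN
  · simp [empiricalMeasure]
  have h0 : ∀ i, 0 ≤ A.indicator (fun _ => (1 : ℝ)) (x i) :=
    fun i => Set.indicator_nonneg (fun _ _ => zero_le_one) _
  rw [ENNReal.ofReal_mul (by positivity), ENNReal.ofReal_inv_of_pos (by positivity),
    ENNReal.ofReal_natCast, ENNReal.ofReal_sum_of_nonneg fun i _ => h0 i, empiricalMeasure,
    Measure.smul_apply, Measure.finsetSum_apply, smul_eq_mul]
  congr 1
  refine Finset.sum_congr rfl fun i _ => ?_
  rw [Measure.dirac_apply' _ hA]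
  by_cases h : x i ∈ A <;> simp [h]

lemma isProbabilityMeasure_empiricalMeasure (hN : N ≠ 0) (x : Fin N → EuclideanSpace ℝ (Fin d)) :
    IsProbabilityMeasure (empiricalMeasure x) := by
  refine ⟨?_⟩
  rw [empiricalMeasure_apply x MeasurableSet.univ]
  have : (N : ℝ) ≠ 0 := by exact_mod_cast hN
  simp [this]

lemma lintegral_empiricalMeasure (x : Fin N → EuclideanSpace ℝ (Fin d))
    {f : EuclideanSpace ℝ (Fin d) → ℝ≥0∞} :
    ∫⁻ y, f y ∂(empiricalMeasure x) = (N : ℝ≥0∞)⁻¹ * ∑ i, f (x i) := by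
  rw [empiricalMeasure, lintegral_smul_measure, lintegral_finsetSum_measure, smul_eq_mul]
  simp

variable {Ω : Type*} [MeasurableSpace Ω] {P : Measure Ω}
  {μ : Measure (EuclideanSpace ℝ (Fin d))}
  {Y : Fin N → Ω → EuclideanSpace ℝ (Fin d)}

/-- The empirical integral of a nonnegative function is unbiased. -/
lemma lintegral_lintegral_empiricalMeasure (hN : N ≠ 0) (hY : ∀ i, HasLaw (Y i) μ P)
    {f : EuclideanSpace ℝ (Fin d) → ℝ≥0∞} (hf : Measurable f) :
    ∫⁻ ω, ∫⁻ y, f y ∂(empiricalMeasure fun i => Y i ω) ∂P = ∫⁻ y, f y ∂μ := by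
  simp_rw [lintegral_empiricalMeasure]
  have hm : ∀ i ∈ Finset.univ, AEMeasurable (fun ω => f (Y i ω)) P :=
    fun i _ => hf.comp_aemeasurable (hY i).aemeasurable
  rw [lintegral_const_mul'' _ (Finset.aemeasurable_fun_sum _ hm),
    lintegral_finsetSum' _ hm]
  have : ∀ i, ∫⁻ ω, f (Y i ω) ∂P = ∫⁻ y, f y ∂μ := fun i =>
    (hY i).lintegral_comp hf.aemeasurable
  simp_rw [this]
  rw [Finset.sum_const, Finset.card_univ, Fintype.card_fin, nsmul_eq_mul, ← mul_assoc,
    ENNReal.inv_mul_cancel (by exact_mod_cast hN) (ENNReal.natCast_ne_top N), one_mul]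

lemma aemeasurable_empiricalMeasure_apply (hY : ∀ i, HasLaw (Y i) μ P)
    {A : Set (EuclideanSpace ℝ (Fin d))} (hA : MeasurableSet A) :
    AEMeasurable (fun ω => empiricalMeasure (fun i => Y i ω) A) P := by
  simp_rw [empiricalMeasure_apply _ hA]
  refine ENNReal.measurable_ofReal.comp_aemeasurable (AEMeasurable.const_mul ?_ _)
  exact Finset.aemeasurable_fun_sum _ fun i _ =>
    (measurable_const.indicator hA).comp_aemeasurable (hY i).aemeasurable

/-- The mean deviation of the empirical mass of a set is at most its standard deviation. -/
lemma lintegral_empiricalMeasure_deviation_le [IsProbabilityMeasure P] [IsProbabilityMeasure μ]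
    (hN : N ≠ 0) (hY : ∀ i, HasLaw (Y i) μ P)
    (hI : iIndepFun Y P) {A : Set (EuclideanSpace ℝ (Fin d))} (hA : MeasurableSet A) :
    ∫⁻ ω, ((empiricalMeasure (fun i => Y i ω) A - μ A) +
      (μ A - empiricalMeasure (fun i => Y i ω) A)) ∂P ≤ ENNReal.ofReal √(μ.real A / N) := by
  have hN' : (N : ℝ) ≠ 0 := by exact_mod_cast hN
  set φ : EuclideanSpace ℝ (Fin d) → ℝ := A.indicator fun _ => (1 : ℝ) with hφ
  have hφm : Measurable φ := measurable_const.indicator hA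
  have hφ0 : ∀ y, 0 ≤ φ y := fun y => Set.indicator_nonneg (fun _ _ => zero_le_one) _
  have hφ1 : ∀ y, φ y ≤ 1 := fun y => Set.indicator_le_self' (fun _ _ => zero_le_one) _
  have hφsq : ∀ y, φ y ^ 2 = φ y := fun y => by
    by_cases h : y ∈ A <;> simp [hφ, h]
  have hX : ∀ i, MemLp (fun ω => φ (Y i ω)) 2 P := fun i =>
    MemLp.of_bound (hφm.comp_aemeasurable (hY i).aemeasurable).aestronglyMeasurable 1
      (Eventually.of_forall fun ω => by
        rw [Real.norm_eq_abs, abs_of_nonneg (hφ0 _)]; exact hφ1 _)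
  have hmean : ∀ i, ∫ ω, φ (Y i ω) ∂P = μ.real A := fun i => by
    have := (hY i).integral_comp (f := φ) hφm.aestronglyMeasurable
    rw [show (∫ ω, φ (Y i ω) ∂P) = ∫ ω, (φ ∘ Y i) ω ∂P from rfl, this, hφ,
      integral_indicator_const _ hA]
    simp
  have hvar : ∀ i, variance (fun ω => φ (Y i ω)) P ≤ μ.real A := fun i => by
    refine (variance_le_expectation_sq (hX i).1).trans ?_
    rw [← hmean i]
    exact le_of_eq (integral_congr_ae (Eventually.of_forall fun ω => hφsq _))
  set Z : Ω → ℝ := fun ω => (N : ℝ)⁻¹ * ∑ i, φ (Y i ω) with hZ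
  have hsum : MemLp (∑ i, fun ω => φ (Y i ω)) 2 P := memLp_finsetSum' _ fun i _ => hX i
  have hZ' : Z = fun ω => (N : ℝ)⁻¹ * (∑ i, fun ω => φ (Y i ω)) ω := by
    ext ω; simp [hZ]
  have hZ2 : MemLp Z 2 P := by rw [hZ']; exact hsum.const_mul _
  have hZm : ∫ ω, Z ω ∂P = μ.real A := by
    rw [hZ, integral_const_mul, integral_finsetSum _ fun i _ => (hX i).integrable one_le_two]
    simp_rw [hmean]
    simp [hN']
  have hZv : variance Z P ≤ μ.real A / N := by
    rw [hZ', variance_const_mul, IndepFun.variance_sum (fun i _ => hX i)]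
    · calc ((N : ℝ)⁻¹) ^ 2 * ∑ i, variance (fun ω => φ (Y i ω)) P
          ≤ ((N : ℝ)⁻¹) ^ 2 * ∑ i : Fin N, μ.real A := by
            gcongr with i; exact hvar i
        _ = μ.real A / N := by
            simp only [Finset.sum_const, Finset.card_univ, Fintype.card_fin, nsmul_eq_mul]
            field_simp
    · intro i _ j _ hij
      exact (hI.indepFun hij).comp hφm hφm
  have hD : MemLp (fun ω => |Z ω - μ.real A|) 2 P := by
    have : MemLp (fun ω => Z ω - μ.real A) 2 P := hZ2.sub (memLp_const _)
    exact this.norm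
  have hEq : ∀ ω, ((empiricalMeasure (fun i => Y i ω) A - μ A) +
      (μ A - empiricalMeasure (fun i => Y i ω) A)) = ENNReal.ofReal |Z ω - μ.real A| := by
    intro ω
    rw [empiricalMeasure_apply _ hA, ← ofReal_measureReal (measure_ne_top μ A),
      ENNReal.ofReal_sub_add_ofReal_sub _ measureReal_nonneg]
    exact mul_nonneg (by positivity) (Finset.sum_nonneg fun i _ => hφ0 _)
  simp_rw [hEq]
  rw [← ofReal_integral_eq_lintegral_ofReal (hD.integrable one_le_two)
    (Eventually.of_forall fun ω => abs_nonneg _)]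
  refine ENNReal.ofReal_le_ofReal (Real.le_sqrt_of_sq_le ?_)
  -- Nonnegativity of this variance is the inequality `(E|Z - EZ|)² ≤ Var Z`.
  have h1 := variance_nonneg (fun ω => |Z ω - μ.real A|) P
  rw [variance_eq_sub hD] at h1
  have h2 : ∫ ω, ((fun ω => |Z ω - μ.real A|) ^ 2) ω ∂P = variance Z P := by
    rw [variance_eq_integral hZ2.1.aemeasurable, hZm]
    simp [sq_abs]
  rw [h2] at h1
  linarith

end Empirical

/-! ### Anisotropic shells and dyadic cubes. -/

section Cells

variable {d : ℕ}

/-- The sixth power of the `ℓ⁶` norm after rescaling each coordinate by `s i`. -/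
noncomputable def scaledPow (s : Fin d → ℝ) (y : EuclideanSpace ℝ (Fin d)) : ℝ :=
  ∑ i, (y i / s i) ^ 6

/-- The least `n` with `scaledPow s y ≤ 64 ^ n`. -/
noncomputable def shell (s : Fin d → ℝ) (y : EuclideanSpace ℝ (Fin d)) : ℕ :=
  Nat.clog 64 ⌈scaledPow s y⌉₊

/-- The cell of `y`: its shell `n`, and the cube of side `2 ^ n * ε` that contains it. -/
noncomputable def cell (s : Fin d → ℝ) (ε : ℝ) (y : EuclideanSpace ℝ (Fin d)) :
    ℕ × (Fin d → ℤ) :=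
  (shell s y, fun i => ⌊y i / (2 ^ shell s y * ε)⌋)

lemma scaledPow_nonneg (s : Fin d → ℝ) (y : EuclideanSpace ℝ (Fin d)) : 0 ≤ scaledPow s y :=
  Finset.sum_nonneg fun i _ => by positivity

lemma measurable_scaledPow (s : Fin d → ℝ) : Measurable (scaledPow s) := by
  unfold scaledPow; fun_prop

lemma measurable_shell (s : Fin d → ℝ) : Measurable (shell s) :=
  (measurable_of_countable _).comp (Nat.measurable_ceil.comp (measurable_scaledPow s))

lemma measurable_cell (s : Fin d → ℝ) (ε : ℝ) : Measurable (cell s ε) := by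
  refine (measurable_shell s).prodMk (measurable_pi_lambda _ fun i => Int.measurable_floor.comp ?_)
  have h : Measurable fun y : EuclideanSpace ℝ (Fin d) => (2 : ℝ) ^ shell s y :=
    (measurable_of_countable fun n : ℕ => (2 : ℝ) ^ n).comp (measurable_shell s)
  have h' : Measurable fun y : EuclideanSpace ℝ (Fin d) => y i := by fun_prop
  exact h'.div (h.mul_const _)

lemma scaledPow_le (s : Fin d → ℝ) (y : EuclideanSpace ℝ (Fin d)) :
    scaledPow s y ≤ 64 ^ shell s y := by
  have h : ⌈scaledPow s y⌉₊ ≤ 64 ^ shell s y := Nat.le_pow_clog (by norm_num) _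
  exact_mod_cast (Nat.le_ceil _).trans (Nat.cast_le (α := ℝ).2 h)

lemma abs_le_of_shell {s : Fin d → ℝ} (hs : ∀ i, 0 < s i) (y : EuclideanSpace ℝ (Fin d))
    (i : Fin d) : |y i| ≤ 2 ^ shell s y * s i := by
  have h1 : (y i / s i) ^ 6 ≤ scaledPow s y :=
    Finset.single_le_sum (f := fun i => (y i / s i) ^ 6) (fun i _ => by positivity)
      (Finset.mem_univ i)
  have h2 : |y i / s i| ^ 6 ≤ (2 ^ shell s y) ^ 6 := by
    rw [Even.pow_abs (by decide), ← pow_mul, mul_comm, pow_mul]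
    exact h1.trans ((scaledPow_le s y).trans (by norm_num))
  have h3 := le_of_pow_le_pow_left₀ (by norm_num) (by positivity) h2
  rwa [abs_div, abs_of_pos (hs i), div_le_iff₀ (hs i)] at h3

/-- Minimality of the shell index: outside shell `0` the previous power of `64` is already exceeded.
The summand `1` takes care of shell `0`. -/
lemma pow_shell_le (s : Fin d → ℝ) (y : EuclideanSpace ℝ (Fin d)) :
    (64 : ℝ) ^ shell s y ≤ 64 * (1 + scaledPow s y) := by
  have h0 := scaledPow_nonneg s y
  rcases Nat.eq_zero_or_pos (shell s y) with h | h
  · rw [h]; linarith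
  obtain ⟨m, hm⟩ := Nat.exists_eq_add_of_lt h
  have h1 : m < Nat.clog 64 ⌈scaledPow s y⌉₊ := by
    change m < shell s y; omega
  rw [Nat.lt_clog_iff_pow_lt (by norm_num), Nat.lt_ceil] at h1
  push_cast at h1
  rw [hm, zero_add, pow_succ]
  linarith

/-- Nesting of the grids: shells do not depend on `ε`, and `⌊t / 2⌋` is determined by `⌊t⌋`. -/
lemma cell_two_mul {s : Fin d → ℝ} {ε : ℝ} {x y : EuclideanSpace ℝ (Fin d)}
    (h : cell s ε x = cell s ε y) : cell s (2 * ε) x = cell s (2 * ε) y := by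
  have h1 : shell s x = shell s y := congrArg Prod.fst h
  have h2 : ∀ i, ⌊x i / (2 ^ shell s x * ε)⌋ = ⌊y i / (2 ^ shell s y * ε)⌋ :=
    fun i => congrFun (congrArg Prod.snd h) i
  have key : ∀ (z : EuclideanSpace ℝ (Fin d)) i, ⌊z i / (2 ^ shell s z * (2 * ε))⌋ =
      ⌊z i / (2 ^ shell s z * ε)⌋ / (2 : ℕ) := fun z i => by
    rw [← Int.floor_div_natCast, div_div]
    congr 2
    push_cast; ring
  refine Prod.ext h1 (funext fun i => ?_)
  change ⌊x i / (2 ^ shell s x * (2 * ε))⌋ = ⌊y i / (2 ^ shell s y * (2 * ε))⌋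
  rw [key, key, h2]

lemma norm_sub_sq_le_of_cell {s : Fin d → ℝ} {ε : ℝ} (hε : 0 < ε)
    {x y : EuclideanSpace ℝ (Fin d)} (h : cell s ε x = cell s ε y) :
    ‖x - y‖ ^ 2 ≤ d * ε ^ 2 * 4 ^ shell s x := by
  have h1 : shell s x = shell s y := congrArg Prod.fst h
  have h2 : ∀ i, ⌊x i / (2 ^ shell s x * ε)⌋ = ⌊y i / (2 ^ shell s y * ε)⌋ :=
    fun i => congrFun (congrArg Prod.snd h) i
  rw [EuclideanSpace.norm_sq_eq]
  have h3 : ∀ i, ‖(x - y) i‖ ^ 2 ≤ ε ^ 2 * 4 ^ shell s x := fun i => by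
    have h4 := (Int.abs_sub_lt_one_of_floor_eq_floor (h2 i)).le
    have hpos : 0 < 2 ^ shell s x * ε := by positivity
    rw [← h1, ← sub_div, abs_div, abs_of_pos hpos, div_le_one hpos] at h4
    rw [PiLp.sub_apply, Real.norm_eq_abs]
    calc |x i - y i| ^ 2 ≤ (2 ^ shell s x * ε) ^ 2 := by gcongr
      _ = ε ^ 2 * 4 ^ shell s x := by
        rw [mul_pow, ← pow_mul, mul_comm (shell s x), pow_mul]; norm_num; ring
  calc ∑ i, ‖(x - y) i‖ ^ 2 ≤ ∑ _i : Fin d, ε ^ 2 * 4 ^ shell s x :=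
        Finset.sum_le_sum fun i _ => h3 i
    _ = _ := by simp; ring

/-- Serves the last matching, where the two points may lie in different shells and only their norms
are controlled. -/
lemma norm_sq_le_of_shell {s : Fin d → ℝ} (hs : ∀ i, 0 < s i) (x : EuclideanSpace ℝ (Fin d)) :
    ‖x‖ ^ 2 ≤ (∑ i, s i ^ 2) * 4 ^ shell s x := by
  rw [EuclideanSpace.norm_sq_eq, Finset.sum_mul]
  refine Finset.sum_le_sum fun i _ => ?_
  rw [Real.norm_eq_abs]
  calc |x i| ^ 2 ≤ (2 ^ shell s x * s i) ^ 2 := by gcongr; exact abs_le_of_shell hs x i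
    _ = _ := by rw [mul_pow, ← pow_mul, mul_comm (shell s x), pow_mul]; norm_num; ring

/-- The cubes that can meet a given shell. -/
noncomputable def cubes (s : Fin d → ℝ) (ε : ℝ) : Finset (Fin d → ℤ) :=
  Fintype.piFinset fun i => Finset.Icc ⌊-(s i / ε)⌋ ⌊s i / ε⌋

lemma cell_snd_mem_cubes {s : Fin d → ℝ} (hs : ∀ i, 0 < s i) {ε : ℝ} (hε : 0 < ε)
    (y : EuclideanSpace ℝ (Fin d)) : (cell s ε y).2 ∈ cubes s ε := by
  rw [cubes, Fintype.mem_piFinset]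
  intro i
  have h := abs_le.1 (abs_le_of_shell hs y i)
  have h2 : (0 : ℝ) < 2 ^ shell s y := by positivity
  rw [Finset.mem_Icc]
  constructor <;> refine Int.floor_mono ?_
  · rw [le_div_iff₀ (by positivity)]
    calc -(s i / ε) * (2 ^ shell s y * ε) = -(2 ^ shell s y * s i) := by field_simp
      _ ≤ y i := h.1
  · rw [div_le_iff₀ (by positivity)]
    calc y i ≤ 2 ^ shell s y * s i := h.2
      _ = s i / ε * (2 ^ shell s y * ε) := by field_simp

/-- Direction `i` has at most `2 s_i/ε + 2` intervals, and `ε ≤ s i` absorbs the `2`. The shell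
index is absent because box and cubes both scale like `2^n`. -/
lemma card_cubes_le {s : Fin d → ℝ} {ε : ℝ} (hε : 0 < ε) (hs : ∀ i, ε ≤ s i) :
    ((cubes s ε).card : ℝ) ≤ 4 ^ d * (∏ i, s i) / ε ^ d := by
  rw [cubes, Fintype.card_piFinset, Nat.cast_prod]
  calc ∏ i, (((Finset.Icc ⌊-(s i / ε)⌋ ⌊s i / ε⌋).card : ℕ) : ℝ) ≤ ∏ i, 4 * (s i / ε) := by
        refine Finset.prod_le_prod (fun i _ => Nat.cast_nonneg _) fun i _ => ?_
        have h1 : 1 ≤ s i / ε := (one_le_div hε).2 (hs i)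
        have h2 : ⌊-(s i / ε)⌋ ≤ ⌊s i / ε⌋ := Int.floor_mono (by linarith)
        have h3 := Int.floor_le (s i / ε)
        have h4 := Int.lt_floor_add_one (-(s i / ε))
        rw [Int.card_Icc, ← Int.cast_natCast, Int.toNat_of_nonneg (by omega)]
        push_cast
        linarith
    _ = _ := by
        rw [Finset.prod_mul_distrib, Finset.prod_div_distrib]
        simp [mul_div_assoc]

variable {μ : Measure (EuclideanSpace ℝ (Fin d))} [IsProbabilityMeasure μ]

lemma lintegral_pow_shell_le {s : Fin d → ℝ}
    (hμ : ∫⁻ y, ENNReal.ofReal (scaledPow s y) ∂μ ≤ d) :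
    ∫⁻ y, ENNReal.ofReal (64 ^ shell s y) ∂μ ≤ ENNReal.ofReal (64 * (1 + d)) := by
  calc ∫⁻ y, ENNReal.ofReal (64 ^ shell s y) ∂μ
      ≤ ∫⁻ y, 64 * (1 + ENNReal.ofReal (scaledPow s y)) ∂μ := by
        refine lintegral_mono fun y => (ENNReal.ofReal_le_ofReal (pow_shell_le s y)).trans ?_
        rw [ENNReal.ofReal_mul (by norm_num), ENNReal.ofReal_add zero_le_one (scaledPow_nonneg s y)]
        simp
    _ = 64 * (1 + ∫⁻ y, ENNReal.ofReal (scaledPow s y) ∂μ) := by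
        rw [lintegral_const_mul' _ _ (by norm_num), lintegral_add_left measurable_const]
        simp
    _ ≤ 64 * (1 + d) := by gcongr
    _ = _ := by
        rw [ENNReal.ofReal_mul (by norm_num), ENNReal.ofReal_add zero_le_one (by positivity)]
        simp

/-- Markov's inequality for `64 ^ shell`. -/
lemma measureReal_shell_le {s : Fin d → ℝ}
    (hμ : ∫⁻ y, ENNReal.ofReal (scaledPow s y) ∂μ ≤ d) (n : ℕ) :
    μ.real (shell s ⁻¹' {n}) ≤ 64 * (1 + d) / 64 ^ n := by
  have hm : MeasurableSet (shell s ⁻¹' {n}) := measurable_shell s (measurableSet_singleton n)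
  have h1 : ENNReal.ofReal (64 ^ n) * μ (shell s ⁻¹' {n}) ≤ ENNReal.ofReal (64 * (1 + d)) := by
    refine le_trans ?_ (lintegral_pow_shell_le hμ)
    rw [← setLIntegral_const]
    calc ∫⁻ _ in shell s ⁻¹' {n}, ENNReal.ofReal (64 ^ n) ∂μ
        = ∫⁻ y in shell s ⁻¹' {n}, ENNReal.ofReal (64 ^ shell s y) ∂μ := by
          refine setLIntegral_congr_fun hm fun y hy => ?_
          have hy' : shell s y = n := hy
          simp only [hy']
      _ ≤ _ := setLIntegral_le_lintegral _ _
  have h2 := ENNReal.toReal_mono ENNReal.ofReal_ne_top h1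
  rw [ENNReal.toReal_mul, ENNReal.toReal_ofReal (by positivity),
    ENNReal.toReal_ofReal (by positivity)] at h2
  rw [le_div_iff₀ (by positivity), mul_comm]
  exact h2

/-- Summing the standard deviations of the cells of one shell. -/
lemma tsum_sqrt_cell_le {s : Fin d → ℝ} {ε : ℝ} (hε : 0 < ε) (hs : ∀ i, ε ≤ s i)
    (hμ : ∫⁻ y, ENNReal.ofReal (scaledPow s y) ∂μ ≤ d) (N n : ℕ) :
    ∑' z, ENNReal.ofReal √(μ.real (cell s ε ⁻¹' {(n, z)}) / N) ≤
      ENNReal.ofReal ((1 / 8) ^ n * √(4 ^ d * (64 * (1 + d)) * (∏ i, s i) / ε ^ d / N)) := by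
  have hs0 : ∀ i, 0 < s i := fun i => hε.trans_le (hs i)
  have hP : 0 < ∏ i, s i := Finset.prod_pos fun i _ => hs0 i
  rw [tsum_eq_sum (s := cubes s ε), ← ENNReal.ofReal_sum_of_nonneg fun _ _ => Real.sqrt_nonneg _]
  swap
  · intro z hz
    have : cell s ε ⁻¹' {(n, z)} = ∅ := by
      ext y
      simp only [Set.mem_preimage, Set.mem_singleton_iff, Set.mem_empty_iff_false, iff_false]
      intro hy
      exact hz (by simpa [hy] using cell_snd_mem_cubes hs0 hε y)
    simp [this]
  refine ENNReal.ofReal_le_ofReal ?_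
  have hsum : ∑ z ∈ cubes s ε, μ.real (cell s ε ⁻¹' {(n, z)}) ≤ μ.real (shell s ⁻¹' {n}) := by
    rw [← measureReal_biUnion_finset]
    · refine measureReal_mono ?_
      intro y hy
      simp only [Set.mem_iUnion, Set.mem_preimage, Set.mem_singleton_iff] at hy ⊢
      obtain ⟨z, _, hz⟩ := hy
      exact congrArg Prod.fst hz
    · intro z _ z' _ hzz
      exact Disjoint.preimage _ (by simpa using hzz)
    · exact fun z _ => measurable_cell s ε (measurableSet_singleton _)
  -- Cauchy–Schwarz; the masses of the cubes then add up to at most that of the shell.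
  calc ∑ z ∈ cubes s ε, √(μ.real (cell s ε ⁻¹' {(n, z)}) / N)
      ≤ √((cubes s ε).card * ∑ z ∈ cubes s ε, μ.real (cell s ε ⁻¹' {(n, z)}) / N) := by
        refine Real.le_sqrt_of_sq_le (sq_sum_le_card_mul_sum_sq.trans (le_of_eq ?_))
        congr 1
        exact Finset.sum_congr rfl fun z _ => Real.sq_sqrt (by positivity)
    _ ≤ √((4 ^ d * (∏ i, s i) / ε ^ d) * ((64 * (1 + d) / 64 ^ n) / N)) := by
        rw [← Finset.sum_div]
        refine Real.sqrt_le_sqrt ?_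
        gcongr
        · exact card_cubes_le hε hs
        · exact hsum.trans (measureReal_shell_le hμ n)
    _ = √(((1 / 8) ^ n) ^ 2 * (4 ^ d * (64 * (1 + d)) * (∏ i, s i) / ε ^ d / N)) := by
        congr 1
        rw [← pow_mul, mul_comm n 2, pow_mul, show ((1 : ℝ) / 8) ^ 2 = 1 / 64 by norm_num,
          div_pow, one_pow]
        field_simp
    _ = _ := by rw [Real.sqrt_mul (by positivity), Real.sqrt_sq (by positivity)]

/-- Summing the weighted standard deviations of all cells. -/
lemma tsum_weight_sqrt_cell_le {s : Fin d → ℝ} {ε : ℝ} (hε : 0 < ε) (hs : ∀ i, ε ≤ s i)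
    (hμ : ∫⁻ y, ENNReal.ofReal (scaledPow s y) ∂μ ≤ d) (N : ℕ) {κ : ℝ} (hκ : 0 ≤ κ) :
    ∑' j : ℕ × (Fin d → ℤ), ENNReal.ofReal (κ * 4 ^ j.1) *
        ENNReal.ofReal √(μ.real (cell s ε ⁻¹' {j}) / N) ≤
      ENNReal.ofReal (2 * κ * √(4 ^ d * (64 * (1 + d)) * (∏ i, s i) / ε ^ d / N)) := by
  set R := √(4 ^ d * (64 * (1 + d)) * (∏ i, s i) / ε ^ d / N) with hR
  have hR0 : 0 ≤ R := Real.sqrt_nonneg _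
  rw [ENNReal.tsum_prod']
  have hg : HasSum (fun n : ℕ => κ * R * (1 / 2) ^ n) (κ * R * 2) := hasSum_geometric_two.mul_left _
  calc ∑' n : ℕ, ∑' z : Fin d → ℤ, ENNReal.ofReal (κ * 4 ^ n) *
        ENNReal.ofReal √(μ.real (cell s ε ⁻¹' {(n, z)}) / N)
      ≤ ∑' n : ℕ, ENNReal.ofReal (κ * R * (1 / 2) ^ n) := by
        refine ENNReal.tsum_le_tsum fun n => ?_
        rw [ENNReal.tsum_mul_left]
        refine (mul_le_mul_right (tsum_sqrt_cell_le hε hs hμ N n) _).trans (le_of_eq ?_)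
        rw [← ENNReal.ofReal_mul (by positivity)]
        congr 1
        -- The moment assumption pays off here: moments of order `p` would give `4^n 2^{-pn/2}`,
        -- summable exactly when `p > 4`.
        rw [show ((1 : ℝ) / 2) ^ n = 4 ^ n * (1 / 8) ^ n by rw [← mul_pow]; norm_num]
        ring
    _ = ENNReal.ofReal (κ * R * 2) := by
        rw [← ENNReal.ofReal_tsum_of_nonneg (fun n => by positivity) hg.summable, hg.tsum_eq]
    _ = _ := by ring_nf

end Cells

/-! ### The multiscale bound, pathwise and in mean. -/

section Multiscale

variable {d : ℕ}

lemma W2_sq_le {μ ν : Measure (EuclideanSpace ℝ (Fin d))}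
    {γ : Measure (EuclideanSpace ℝ (Fin d) × EuclideanSpace ℝ (Fin d))} (hγ : γ ∈ couplings μ ν) :
    W2 μ ν ^ 2 ≤ ∫⁻ p, ‖p.1 - p.2‖ₑ ^ 2 ∂γ := by
  have h : W2 μ ν ≤ (∫⁻ p, ‖p.1 - p.2‖ₑ ^ 2 ∂γ) ^ (1 / 2 : ℝ) := iInf₂_le γ hγ
  calc W2 μ ν ^ 2 ≤ ((∫⁻ p, ‖p.1 - p.2‖ₑ ^ 2 ∂γ) ^ (1 / 2 : ℝ)) ^ 2 := by gcongr
    _ = _ := by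
      rw [← ENNReal.rpow_natCast, ← ENNReal.rpow_mul]
      norm_num

lemma enorm_sq_le_ofReal {E : Type*} [SeminormedAddCommGroup E] {x : E} {a : ℝ}
    (h : ‖x‖ ^ 2 ≤ a) : ‖x‖ₑ ^ 2 ≤ ENNReal.ofReal a := by
  rw [← ofReal_norm, ← ENNReal.ofReal_pow (norm_nonneg _)]
  exact ENNReal.ofReal_le_ofReal h

/-- The weight of the cells of scale `k` in the multiscale bound; the scales are
`ε, …, 2 ^ K * ε`. -/
noncomputable def scaleWeight (s : Fin d → ℝ) (ε : ℝ) (K k : ℕ) : ℝ :=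
  if k < K then d * (2 ^ (k + 1) * ε) ^ 2 else 2 * ∑ i, s i ^ 2

lemma scaleWeight_nonneg (s : Fin d → ℝ) (ε : ℝ) (K k : ℕ) : 0 ≤ scaleWeight s ε K k := by
  unfold scaleWeight
  split_ifs
  · positivity
  · exact mul_nonneg zero_le_two (Finset.sum_nonneg fun i _ => sq_nonneg _)

/-- Pathwise multiscale bound for the squared `W₂` distance. -/
lemma W2_sq_le_multiscale {s : Fin d → ℝ} (hs : ∀ i, 0 < s i) {ε : ℝ} (hε : 0 < ε) (K : ℕ)
    (μ ν : Measure (EuclideanSpace ℝ (Fin d))) [IsProbabilityMeasure μ] [IsProbabilityMeasure ν] :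
    W2 μ ν ^ 2 ≤ ∫⁻ y, ENNReal.ofReal (d * ε ^ 2 * 4 ^ shell s y) ∂μ +
      ∫⁻ y, ENNReal.ofReal (d * ε ^ 2 * 4 ^ shell s y) ∂ν +
      ∑ k ∈ Finset.range (K + 1), ∑' j : ℕ × (Fin d → ℤ),
        ENNReal.ofReal (scaleWeight s ε K k * 4 ^ j.1) *
          ((μ (cell s (2 ^ k * ε) ⁻¹' {j}) - ν (cell s (2 ^ k * ε) ⁻¹' {j})) +
           (ν (cell s (2 ^ k * ε) ⁻¹' {j}) - μ (cell s (2 ^ k * ε) ⁻¹' {j}))) := by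
  -- Beyond scale `K` the partition is trivial, so step `K + 1` matches everything that remains.
  set q : ℕ → EuclideanSpace ℝ (Fin d) → ℕ × (Fin d → ℤ) := fun k =>
    if k ≤ K then cell s (2 ^ k * ε) else fun _ => 0 with hq
  have hqle : ∀ k, k ≤ K → q k = cell s (2 ^ k * ε) := fun k hk => if_pos hk
  have hqgt : ∀ k, K < k → q k = fun _ => 0 := fun k hk => if_neg (not_le.2 hk)
  -- The value `∞` makes the cost bound trivial for `k > K`; these indices never enter the sum.
  set β : ℕ → ℕ × (Fin d → ℤ) → ℝ≥0∞ := fun k j =>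
    if k ≤ K then ENNReal.ofReal (scaleWeight s ε K k * 4 ^ j.1) else ∞ with hβ
  have hβle : ∀ k j, k ≤ K → β k j = ENNReal.ofReal (scaleWeight s ε K k * 4 ^ j.1) :=
    fun k j hk => if_pos hk
  have hqm : ∀ k, Measurable (q k) := fun k => by
    rcases le_or_gt k K with h | h
    · rw [hqle k h]; exact measurable_cell _ _
    · rw [hqgt k h]; exact measurable_const
  have hnest : ∀ k x y, q k x = q k y → q (k + 1) x = q (k + 1) y := by
    intro k x y h
    rcases le_or_gt (k + 1) K with hk | hk
    · rw [hqle _ (by omega)] at h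
      rw [hqle _ hk, pow_succ', mul_assoc]
      exact cell_two_mul h
    · rw [hqgt _ hk]
  have hb : Measurable fun y : EuclideanSpace ℝ (Fin d) =>
      ENNReal.ofReal (d * ε ^ 2 * 4 ^ shell s y) :=
    (measurable_of_countable fun n : ℕ => ENNReal.ofReal (d * ε ^ 2 * 4 ^ n)).comp
      (measurable_shell s)
  have hc0 : ∀ x y : EuclideanSpace ℝ (Fin d), q 0 x = q 0 y → ‖(x, y).1 - (x, y).2‖ₑ ^ 2 ≤
      ENNReal.ofReal (d * ε ^ 2 * 4 ^ shell s x) + ENNReal.ofReal (d * ε ^ 2 * 4 ^ shell s y) := by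
    intro x y h
    rw [hqle 0 (Nat.zero_le _), pow_zero, one_mul] at h
    exact (enorm_sq_le_ofReal (norm_sub_sq_le_of_cell hε h)).trans le_self_add
  have hc : ∀ k, ∀ x y : EuclideanSpace ℝ (Fin d), q (k + 1) x = q (k + 1) y →
      ‖(x, y).1 - (x, y).2‖ₑ ^ 2 ≤ β k (q k x) + β k (q k y) := by
    intro k x y h
    rcases lt_trichotomy k K with hk | rfl | hk
    · rw [hqle _ hk] at h
      rw [hβle _ _ hk.le, hqle _ hk.le, scaleWeight, if_pos hk]
      exact (enorm_sq_le_ofReal (norm_sub_sq_le_of_cell (by positivity) h)).trans le_self_add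
    · rw [hβle _ _ le_rfl, hβle _ _ le_rfl, hqle _ le_rfl, scaleWeight, if_neg (lt_irrefl _),
        ← ENNReal.ofReal_add (by positivity) (by positivity)]
      refine enorm_sq_le_ofReal ?_
      have hx := norm_sq_le_of_shell hs x
      have hy := norm_sq_le_of_shell hs y
      have hxy : ‖x - y‖ ^ 2 ≤ 2 * ‖x‖ ^ 2 + 2 * ‖y‖ ^ 2 := by
        have := pow_le_pow_left₀ (norm_nonneg _) (norm_sub_le x y) 2
        nlinarith [sq_nonneg (‖x‖ - ‖y‖)]
      change ‖x - y‖ ^ 2 ≤ 2 * (∑ i, s i ^ 2) * 4 ^ shell s x + 2 * (∑ i, s i ^ 2) * 4 ^ shell s y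
      linarith
    · have : β k (q k x) = ∞ := if_neg (not_le.2 hk)
      rw [this]; simp
  obtain ⟨γ, h1, h2, h3⟩ := exists_coupling_of_multiscale
    (c := fun p : EuclideanSpace ℝ (Fin d) × EuclideanSpace ℝ (Fin d) => ‖p.1 - p.2‖ₑ ^ 2)
    hqm hnest hb hc0 hc μ ν
    (K := K + 1) (i₀ := 0) (fun x => by rw [hqgt _ (Nat.lt_succ_self K)])
  have hprob : IsProbabilityMeasure γ := by
    have : IsProbabilityMeasure (γ.map Prod.fst) := by rw [h1]; infer_instance
    exact Measure.isProbabilityMeasure_of_map Prod.fst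
  refine (W2_sq_le ⟨hprob, h1, h2⟩).trans (h3.trans (le_of_eq ?_))
  congr 1
  refine Finset.sum_congr rfl fun k hk => tsum_congr fun j => ?_
  have hk' : k ≤ K := Nat.lt_succ_iff.1 (Finset.mem_range.1 hk)
  rw [hβle _ _ hk', hqle _ hk']

/-- Multiscale bound for the mean squared `W₂` distance of the empirical measure. -/
lemma lintegral_W2_sq_le {N : ℕ} (hN : N ≠ 0) {Ω : Type*} [MeasurableSpace Ω] {P : Measure Ω}
    [IsProbabilityMeasure P] {μ : Measure (EuclideanSpace ℝ (Fin d))} [IsProbabilityMeasure μ]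
    {Y : Fin N → Ω → EuclideanSpace ℝ (Fin d)} (hY : ∀ i, HasLaw (Y i) μ P) (hI : iIndepFun Y P)
    {s : Fin d → ℝ} {ε : ℝ} (hε : 0 < ε) (K : ℕ) (hs : ∀ i, 2 ^ K * ε ≤ s i)
    (hμ : ∫⁻ y, ENNReal.ofReal (scaledPow s y) ∂μ ≤ d) :
    ∫⁻ ω, W2 (empiricalMeasure fun i => Y i ω) μ ^ 2 ∂P ≤
      ENNReal.ofReal (2 * (d * ε ^ 2 * (64 * (1 + d))) + ∑ k ∈ Finset.range (K + 1),
        2 * scaleWeight s ε K k *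
          √(4 ^ d * (64 * (1 + d)) * (∏ i, s i) / (2 ^ k * ε) ^ d / N)) := by
  have hs0 : ∀ i, 0 < s i := fun i => lt_of_lt_of_le (by positivity) (hs i)
  have hb : Measurable fun y : EuclideanSpace ℝ (Fin d) =>
      ENNReal.ofReal (d * ε ^ 2 * 4 ^ shell s y) :=
    (measurable_of_countable fun n : ℕ => ENNReal.ofReal (d * ε ^ 2 * 4 ^ n)).comp
      (measurable_shell s)
  have hbI : ∫⁻ y, ENNReal.ofReal (d * ε ^ 2 * 4 ^ shell s y) ∂μ ≤
      ENNReal.ofReal (d * ε ^ 2 * (64 * (1 + d))) := by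
    have hd : (0 : ℝ) ≤ d * ε ^ 2 := by positivity
    simp_rw [ENNReal.ofReal_mul hd]
    rw [lintegral_const_mul' _ _ ENNReal.ofReal_ne_top]
    gcongr
    refine le_trans (lintegral_mono fun y => ENNReal.ofReal_le_ofReal ?_)
      (lintegral_pow_shell_le hμ)
    gcongr; norm_num
  have hcell : ∀ k j, MeasurableSet (cell s (2 ^ k * ε) ⁻¹' {j}) := fun k j =>
    measurable_cell s _ (measurableSet_singleton j)
  set D : ℕ → (ℕ × (Fin d → ℤ)) → Ω → ℝ≥0∞ := fun k j ω =>
    ((empiricalMeasure fun i => Y i ω) (cell s (2 ^ k * ε) ⁻¹' {j}) -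
        μ (cell s (2 ^ k * ε) ⁻¹' {j})) +
      (μ (cell s (2 ^ k * ε) ⁻¹' {j}) -
        (empiricalMeasure fun i => Y i ω) (cell s (2 ^ k * ε) ⁻¹' {j})) with hD
  have hDm : ∀ k j, AEMeasurable (D k j) P := fun k j =>
    have h := aemeasurable_empiricalMeasure_apply hY (hcell k j)
    (h.sub aemeasurable_const).add (aemeasurable_const.sub h)
  have hterm : ∀ k, k < K + 1 → ∫⁻ ω, ∑' j : ℕ × (Fin d → ℤ),
      ENNReal.ofReal (scaleWeight s ε K k * 4 ^ j.1) * D k j ω ∂P ≤ ENNReal.ofReal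
        (2 * scaleWeight s ε K k *
          √(4 ^ d * (64 * (1 + d)) * (∏ i, s i) / (2 ^ k * ε) ^ d / N)) := by
    intro k hk
    rw [lintegral_tsum fun j => (hDm k j).const_mul _]
    refine le_trans (ENNReal.tsum_le_tsum fun j => ?_) (tsum_weight_sqrt_cell_le (μ := μ)
      (ε := 2 ^ k * ε) (by positivity) (fun i => le_trans ?_ (hs i)) hμ N
      (scaleWeight_nonneg s ε K k))
    · rw [lintegral_const_mul' _ _ ENNReal.ofReal_ne_top]
      gcongr
      exact lintegral_empiricalMeasure_deviation_le hN hY hI (hcell k j)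
    · gcongr
      · norm_num
      · omega
  have hsum0 : ∀ k ∈ Finset.range (K + 1), 0 ≤ 2 * scaleWeight s ε K k *
      √(4 ^ d * (64 * (1 + d)) * (∏ i, s i) / (2 ^ k * ε) ^ d / N) := fun k _ =>
    mul_nonneg (mul_nonneg zero_le_two (scaleWeight_nonneg _ _ _ _)) (Real.sqrt_nonneg _)
  have hSm : ∀ k ∈ Finset.range (K + 1), AEMeasurable (fun ω => ∑' j : ℕ × (Fin d → ℤ),
      ENNReal.ofReal (scaleWeight s ε K k * 4 ^ j.1) * D k j ω) P := fun k _ =>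
    AEMeasurable.tsum fun j => (hDm k j).const_mul _
  calc ∫⁻ ω, W2 (empiricalMeasure fun i => Y i ω) μ ^ 2 ∂P
      ≤ ∫⁻ ω, (∫⁻ y, ENNReal.ofReal (d * ε ^ 2 * 4 ^ shell s y)
          ∂(empiricalMeasure fun i => Y i ω) +
        ∫⁻ y, ENNReal.ofReal (d * ε ^ 2 * 4 ^ shell s y) ∂μ +
        ∑ k ∈ Finset.range (K + 1), ∑' j : ℕ × (Fin d → ℤ),
          ENNReal.ofReal (scaleWeight s ε K k * 4 ^ j.1) * D k j ω) ∂P := by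
        refine lintegral_mono fun ω => ?_
        have := isProbabilityMeasure_empiricalMeasure hN fun i => Y i ω
        exact W2_sq_le_multiscale hs0 hε K _ μ
    _ = ∫⁻ y, ENNReal.ofReal (d * ε ^ 2 * 4 ^ shell s y) ∂μ +
        ∫⁻ y, ENNReal.ofReal (d * ε ^ 2 * 4 ^ shell s y) ∂μ +
        ∑ k ∈ Finset.range (K + 1), ∫⁻ ω, ∑' j : ℕ × (Fin d → ℤ),
          ENNReal.ofReal (scaleWeight s ε K k * 4 ^ j.1) * D k j ω ∂P := by
        rw [lintegral_add_right' _ (Finset.aemeasurable_fun_sum _ hSm),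
          lintegral_add_right _ measurable_const, lintegral_finsetSum' _ hSm,
          lintegral_lintegral_empiricalMeasure hN hY hb, lintegral_const, measure_univ, mul_one]
    _ ≤ ENNReal.ofReal (d * ε ^ 2 * (64 * (1 + d))) + ENNReal.ofReal (d * ε ^ 2 * (64 * (1 + d))) +
        ∑ k ∈ Finset.range (K + 1), ENNReal.ofReal (2 * scaleWeight s ε K k *
          √(4 ^ d * (64 * (1 + d)) * (∏ i, s i) / (2 ^ k * ε) ^ d / N)) := by
        gcongr with k hk
        exact hterm k (Finset.mem_range.1 hk)
    _ = _ := by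
        rw [← ENNReal.ofReal_sum_of_nonneg hsum0,
          ← ENNReal.ofReal_add (by positivity) (by positivity),
          ← ENNReal.ofReal_add (by positivity) (Finset.sum_nonneg hsum0)]
        congr 2
        ring

end Multiscale

/-! ### Choice of the scales and summation. -/

section Rate

variable {d : ℕ}

/-- The last scale is set apart: its weight is not of the order of its squared side, so it is
bounded only for large `N`. The `8` is `2 · 2²`, from the diameter of the next coarser cell. -/
lemma sum_scaleWeight_eq (s : Fin d → ℝ) {ε : ℝ} (K N : ℕ) {A T : ℝ} (hA : 0 ≤ A) :
    ∑ k ∈ Finset.range (K + 1), 2 * scaleWeight s ε K k * √(A * T / (2 ^ k * ε) ^ d / N) =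
      8 * d * √A * ∑ k ∈ Finset.range K, (2 ^ k * ε) ^ 2 * √(T / (2 ^ k * ε) ^ d / N) +
        4 * (∑ i, s i ^ 2) * √(A * T / (2 ^ K * ε) ^ d / N) := by
  rw [Finset.sum_range_succ, Finset.mul_sum]
  congr 1
  · refine Finset.sum_congr rfl fun k hk => ?_
    rw [scaleWeight, if_pos (Finset.mem_range.1 hk), mul_div_assoc, mul_div_assoc,
      Real.sqrt_mul hA]
    ring
  · rw [scaleWeight, if_neg (lt_irrefl _)]
    ring

lemma sqrt_div_natCast (a : ℝ) (ha : 0 ≤ a) (N : ℕ) :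
    √(a / N) = √a * (N : ℝ) ^ (-(1 / 2) : ℝ) := by
  rw [Real.sqrt_div ha, Real.rpow_neg (Nat.cast_nonneg N), ← Real.sqrt_eq_rpow, div_eq_mul_inv]

/-- The exponent in `e^{2 - d/2}` is nonnegative, so `e` may be replaced by `M`. -/
lemma scale_term_le_of_le_four (hd : d ≤ 4) {e M T : ℝ} (he : 0 < e) (heM : e ≤ M) (hT : 0 ≤ T)
    (hTM : T ≤ M ^ d) (N : ℕ) :
    e ^ 2 * √(T / e ^ d / N) ≤ M ^ 2 * (N : ℝ) ^ (-(1 / 2) : ℝ) := by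
  rw [sqrt_div_natCast _ (by positivity), ← mul_assoc]
  gcongr
  have hM : 0 < M := he.trans_le heM
  refine le_of_pow_le_pow_left₀ two_ne_zero (by positivity) ?_
  rw [mul_pow, Real.sq_sqrt (by positivity)]
  obtain ⟨m, hm⟩ := Nat.exists_eq_add_of_le hd
  calc (e ^ 2) ^ 2 * (T / e ^ d) = e ^ m * T := by
        rw [← pow_mul, show 2 * 2 = d + m from hm, pow_add]; field_simp
    _ ≤ M ^ m * M ^ d := by gcongr
    _ = (M ^ 2) ^ 2 := by rw [← pow_add, ← pow_mul, add_comm m, ← hm]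

/-- The left side is `e^2 (E/e)^{d/2}`. Since `E ≤ e` and `d ≥ 5`, it is at most `E^2 (E/e)^{1/2}`,
and `E/e ≤ 2^{-k}`. The ratio `9/16` replaces `1/2` to have a rational square root. -/
lemma scale_term_le_of_four_lt (hd : 4 < d) {e E T : ℝ} {k N : ℕ} (hE : 0 < E)
    (hT : T / N = E ^ d) (he : 2 ^ k * E ≤ e) :
    e ^ 2 * √(T / e ^ d / N) ≤ E ^ 2 * (3 / 4) ^ k := by
  have he0 : 0 < e := lt_of_lt_of_le (by positivity) he
  have hr : E / e ≤ (9 / 16) ^ k := by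
    have h2 : ((1 : ℝ) / 2) ^ k ≤ (9 / 16) ^ k :=
      pow_le_pow_left₀ (by norm_num) (by norm_num) k
    refine le_trans ?_ h2
    rw [div_le_iff₀ he0, div_pow, one_pow, div_mul_eq_mul_div, one_mul, le_div_iff₀ (by positivity)]
    linarith
  have hr1 : E / e ≤ 1 := hr.trans (pow_le_one₀ (by norm_num) (by norm_num))
  refine le_of_pow_le_pow_left₀ two_ne_zero (by positivity) ?_
  rw [div_right_comm, hT, ← div_pow, mul_pow, Real.sq_sqrt (by positivity)]
  calc (e ^ 2) ^ 2 * (E / e) ^ d ≤ (e ^ 2) ^ 2 * (E / e) ^ 5 := by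
        gcongr ?_ * ?_
        exact pow_le_pow_of_le_one (by positivity) hr1 hd
    _ = (E ^ 2) ^ 2 * (E / e) := by field_simp
    _ ≤ (E ^ 2) ^ 2 * (9 / 16) ^ k := by gcongr
    _ = (E ^ 2 * (3 / 4) ^ k) ^ 2 := by
        rw [mul_pow, ← pow_mul (3 / 4 : ℝ), mul_comm k, pow_mul]; norm_num

/-- The dyadic number of scales is of logarithmic order. -/
lemma natLog_add_one_le {N : ℕ} (hN : 2 ≤ N) :
    ((Nat.log 2 N + 1 : ℕ) : ℝ) ≤ 3 * Real.log (1 + N) := by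
  have hN' : (2 : ℝ) ≤ N := by exact_mod_cast hN
  have h1 : ((2 : ℝ) ^ Nat.log 2 N) ≤ 1 + N := by
    have : ((2 ^ Nat.log 2 N : ℕ) : ℝ) ≤ N := by
      exact_mod_cast Nat.pow_log_le_self 2 (by omega)
    push_cast at this
    linarith
  have h2 := Real.log_le_log (by positivity) h1
  rw [Real.log_pow] at h2
  have h3 : 1 ≤ Real.log (1 + N) := by
    rw [Real.le_log_iff_exp_le (by positivity)]
    linarith [Real.exp_one_lt_d9]
  have h4 := Real.log_two_gt_d9
  push_cast
  nlinarith [(Nat.cast_nonneg (Nat.log 2 N) : (0 : ℝ) ≤ _)]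

/-- The constant of the rate. -/
noncomputable def rateConst (d : ℕ) : ℝ :=
  8 * (d * (64 * (1 + d))) + 32 * d * √(4 ^ d * (64 * (1 + d))) + 1

lemma rateConst_pos (d : ℕ) : 0 < rateConst d := by unfold rateConst; positivity

/-- In low dimension, `log N` scales give the rate. -/
lemma eventually_multiscale_le_of_le_four (hd : d ≤ 4) {s : Fin d → ℝ} {δ M : ℝ} (hδ : 0 < δ)
    (hδs : ∀ i, δ ≤ s i) (hδM : δ ≤ M) (hsM : ∀ i, s i ≤ M) :
    ∀ᶠ N : ℕ in atTop, ∃ (K : ℕ) (ε : ℝ), 0 < ε ∧ 2 ^ K * ε = δ ∧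
      2 * (d * ε ^ 2 * (64 * (1 + d))) + ∑ k ∈ Finset.range (K + 1),
        2 * scaleWeight s ε K k *
          √(4 ^ d * (64 * (1 + d)) * (∏ i, s i) / (2 ^ k * ε) ^ d / N) ≤
      rateConst d * M ^ 2 * ((N : ℝ) ^ (-(1 / 2) : ℝ) * Real.log (1 + N)) := by
  set A : ℝ := 4 ^ d * (64 * (1 + d)) with hA
  set T := ∏ i, s i with hT
  have hA0 : 0 ≤ A := by positivity
  have hM : 0 < M := hδ.trans_le hδM
  have hs : ∀ i, 0 < s i := fun i => hδ.trans_le (hδs i)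
  have hT0 : 0 < T := Finset.prod_pos fun i _ => hs i
  have hTM : T ≤ M ^ d := by
    calc T ≤ ∏ _i : Fin d, M := Finset.prod_le_prod (fun i _ => (hs i).le) fun i _ => hsM i
      _ = M ^ d := by simp
  -- The logarithm eventually exceeds the `μ`-dependent factor of the last scale.
  have hlog : Tendsto (fun N : ℕ => M ^ 2 * Real.log (1 + N)) atTop atTop :=
    (Real.tendsto_log_atTop.comp
      (tendsto_atTop_add_const_left _ 1 tendsto_natCast_atTop_atTop)).const_mul_atTop (by positivity)
  filter_upwards [hlog.eventually_ge_atTop (4 * (∑ i, s i ^ 2) * √(A * T / δ ^ d)),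
    eventually_ge_atTop 2] with N h1 hN
  have hN' : (2 : ℝ) ≤ N := by exact_mod_cast hN
  have hL : 1 ≤ Real.log (1 + N) := by
    rw [Real.le_log_iff_exp_le (by positivity)]
    linarith [Real.exp_one_lt_d9]
  set L := Real.log (1 + N) with hLdef
  -- With `2^K > N` the finest side `δ / 2^K` has square at most `M² / N`.
  set K := Nat.log 2 N + 1 with hK
  set n := (N : ℝ) ^ (-(1 / 2) : ℝ) with hn
  have hn0 : 0 ≤ n := by positivity
  have hKe : 2 ^ K * (δ / 2 ^ K) = δ := by field_simp
  refine ⟨K, δ / 2 ^ K, by positivity, hKe, ?_⟩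
  rw [sum_scaleWeight_eq s K N hA0, hKe, sqrt_div_natCast _ (by positivity), ← hn]
  have hε2 : (δ / 2 ^ K) ^ 2 ≤ M ^ 2 * n := by
    have hNK : (N : ℝ) ≤ 2 ^ K := by
      exact_mod_cast (Nat.lt_pow_succ_log_self (by norm_num) N).le
    have hn1 : (N : ℝ)⁻¹ ≤ n := by
      rw [← Real.rpow_neg_one, hn]
      exact Real.rpow_le_rpow_of_exponent_le (by linarith) (by norm_num)
    calc (δ / 2 ^ K) ^ 2 = δ ^ 2 * ((2 ^ K)⁻¹ * (2 ^ K)⁻¹) := by field_simp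
      _ ≤ M ^ 2 * ((N : ℝ)⁻¹ * 1) := by
          gcongr
          exact inv_le_one_of_one_le₀ (one_le_pow₀ (by norm_num))
      _ ≤ M ^ 2 * n := by rw [mul_one]; gcongr
  have hterms : ∑ k ∈ Finset.range K, (2 ^ k * (δ / 2 ^ K)) ^ 2 *
      √(T / (2 ^ k * (δ / 2 ^ K)) ^ d / N) ≤ 3 * L * (M ^ 2 * n) := by
    calc _ ≤ ∑ k ∈ Finset.range K, M ^ 2 * n := by
          refine Finset.sum_le_sum fun k hk => ?_
          refine scale_term_le_of_le_four hd (by positivity) (le_trans ?_ hδM) hT0.le hTM N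
          calc 2 ^ k * (δ / 2 ^ K) ≤ 2 ^ K * (δ / 2 ^ K) := by
                gcongr
                · norm_num
                · exact (Finset.mem_range.1 hk).le
            _ = δ := hKe
      _ = (K : ℝ) * (M ^ 2 * n) := by simp
      _ ≤ _ := by gcongr; exact natLog_add_one_le hN
  have hX : 0 ≤ M ^ 2 * n := by positivity
  calc _ ≤ 2 * (d * (M ^ 2 * n) * (64 * (1 + d))) + (8 * d * √A * (3 * L * (M ^ 2 * n)) +
        M ^ 2 * L * n) := by
        rw [← mul_assoc (4 * _)]
        gcongr
    _ ≤ 8 * (d * (64 * (1 + d))) * (M ^ 2 * n * L) + 32 * d * √A * (M ^ 2 * n * L) +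
        M ^ 2 * n * L := by
        have e1 : M ^ 2 * n ≤ M ^ 2 * n * L := le_mul_of_one_le_right hX hL
        have e2 : 2 * (d * (64 * (1 + d)) : ℝ) * (M ^ 2 * n) ≤
            8 * (d * (64 * (1 + d))) * (M ^ 2 * n * L) := by gcongr; norm_num
        have e3 : 24 * (d * √A * (M ^ 2 * n * L)) ≤ 32 * (d * √A * (M ^ 2 * n * L)) := by
          gcongr; norm_num
        linarith
    _ = _ := by rw [rateConst]; ring

/-- In high dimension, the finest scale dominates. -/
lemma eventually_multiscale_le_of_four_lt (hd : 4 < d) {s : Fin d → ℝ} {δ : ℝ} (hδ : 0 < δ)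
    (hδs : ∀ i, δ ≤ s i) :
    ∀ᶠ N : ℕ in atTop, ∃ (K : ℕ) (ε : ℝ), 0 < ε ∧ 2 ^ K * ε = δ ∧
      2 * (d * ε ^ 2 * (64 * (1 + d))) + ∑ k ∈ Finset.range (K + 1),
        2 * scaleWeight s ε K k *
          √(4 ^ d * (64 * (1 + d)) * (∏ i, s i) / (2 ^ k * ε) ^ d / N) ≤
      rateConst d * (N / ∏ i, s i) ^ (-(2 / (d : ℝ))) := by
  set A : ℝ := 4 ^ d * (64 * (1 + d)) with hA
  set T := ∏ i, s i with hT
  have hA0 : 0 ≤ A := by positivity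
  have hs : ∀ i, 0 < s i := fun i => hδ.trans_le (hδs i)
  have hT0 : 0 < T := Finset.prod_pos fun i _ => hs i
  have hd4 : (4 : ℝ) < d := by exact_mod_cast hd
  have hd0 : (0 : ℝ) < d := by linarith
  have hNT : Tendsto (fun N : ℕ => (N : ℝ) / T) atTop atTop :=
    tendsto_natCast_atTop_atTop.atTop_div_const hT0
  have hE : Tendsto (fun N : ℕ => ((N : ℝ) / T) ^ (-(1 / (d : ℝ)))) atTop (nhds 0) :=
    (tendsto_rpow_neg_atTop (by positivity)).comp hNT
  have hpow : Tendsto (fun N : ℕ => ((N : ℝ) / T) ^ (1 / 2 - 2 / (d : ℝ))) atTop atTop := by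
    refine (tendsto_rpow_atTop ?_).comp hNT
    rw [sub_pos, div_lt_div_iff₀ hd0 two_pos]; linarith
  -- `E < δ` leaves room for dyadic scales between `E` and `δ`. The second condition absorbs the
  -- last scale and needs `1/2 > 2/d`.
  filter_upwards [hE.eventually_lt_const hδ,
    hpow.eventually_ge_atTop (4 * (∑ i, s i ^ 2) * √(A * T / δ ^ d) * T ^ (-(1 / 2) : ℝ)),
    eventually_ge_atTop 1] with N h1 h2 hN
  have hN0 : (0 : ℝ) < N := by exact_mod_cast hN
  set x := (N : ℝ) / T with hx
  have hx0 : 0 < x := by positivity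
  set E := x ^ (-(1 / (d : ℝ))) with hEdef
  have hE0 : 0 < E := by positivity
  have hE2 : x ^ (-(2 / (d : ℝ))) = E ^ 2 := by
    rw [hEdef, ← Real.rpow_natCast, ← Real.rpow_mul hx0.le]
    congr 1
    push_cast; ring
  have hTE : T / N = E ^ d := by
    rw [hEdef, ← Real.rpow_natCast, ← Real.rpow_mul hx0.le, neg_mul, one_div,
      inv_mul_cancel₀ hd0.ne', Real.rpow_neg_one, hx, inv_div]
  -- This `K` puts the finest side `δ / 2^K` between `E` and `2E`.
  obtain ⟨K, hK1, hK2⟩ := exists_nat_pow_near ((one_le_div hE0).2 h1.le) (one_lt_two (α := ℝ))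
  rw [le_div_iff₀ hE0] at hK1
  rw [div_lt_iff₀ hE0] at hK2
  have hKe : 2 ^ K * (δ / 2 ^ K) = δ := by field_simp
  refine ⟨K, δ / 2 ^ K, by positivity, hKe, ?_⟩
  rw [sum_scaleWeight_eq s K N hA0, hKe, sqrt_div_natCast _ (by positivity), hE2]
  have hεE : E ≤ δ / 2 ^ K := by rw [le_div_iff₀ (by positivity)]; linarith
  have hεE2 : δ / 2 ^ K ≤ 2 * E := by
    rw [div_le_iff₀ (by positivity)]; rw [pow_succ] at hK2; linarith
  have hterms : ∑ k ∈ Finset.range K, (2 ^ k * (δ / 2 ^ K)) ^ 2 *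
      √(T / (2 ^ k * (δ / 2 ^ K)) ^ d / N) ≤ E ^ 2 * 4 := by
    calc _ ≤ ∑ k ∈ Finset.range K, E ^ 2 * (3 / 4) ^ k :=
          Finset.sum_le_sum fun k _ => scale_term_le_of_four_lt hd hE0 hTE (by gcongr)
      _ ≤ E ^ 2 * 4 := by
          rw [← Finset.mul_sum]
          gcongr
          have hg := hasSum_geometric_of_lt_one (r := (3 / 4 : ℝ)) (by norm_num) (by norm_num)
          refine (hg.summable.sum_le_tsum _ fun i _ => by positivity).trans ?_
          rw [hg.tsum_eq]; norm_num
  have hlast : 4 * (∑ i, s i ^ 2) * √(A * T / δ ^ d) * (N : ℝ) ^ (-(1 / 2) : ℝ) ≤ E ^ 2 := by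
    have hNx : (N : ℝ) ^ (-(1 / 2) : ℝ) = T ^ (-(1 / 2) : ℝ) * x ^ (-(1 / 2) : ℝ) := by
      rw [← Real.mul_rpow hT0.le hx0.le, hx, mul_div_cancel₀ _ hT0.ne']
    have hxE : E ^ 2 = x ^ (1 / 2 - 2 / (d : ℝ)) * x ^ (-(1 / 2) : ℝ) := by
      rw [← hE2, ← Real.rpow_add hx0]
      congr 1; ring
    rw [hNx, hxE, ← mul_assoc]
    gcongr
  calc _ ≤ 2 * (d * (2 * E) ^ 2 * (64 * (1 + d))) + (8 * d * √A * (E ^ 2 * 4) + E ^ 2) := by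
        rw [← mul_assoc (4 * _)]
        gcongr
    _ = _ := by rw [rateConst]; ring

end Rate

/-! ### The scales `σ_i` satisfy the moment hypotheses. -/

section Moments

variable {d : ℕ} {μ : Measure (EuclideanSpace ℝ (Fin d))}

lemma integrable_coord_pow_six (hμ : Integrable (fun y => l6NormPow y) μ) (i : Fin d) :
    Integrable (fun y : EuclideanSpace ℝ (Fin d) => y i ^ 6) μ := by
  refine hμ.mono' (by fun_prop) (Eventually.of_forall fun y => ?_)
  rw [norm_pow, Real.norm_eq_abs]
  exact Finset.single_le_sum (f := fun i => |y i| ^ 6) (fun i _ => by positivity)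
    (Finset.mem_univ i)

lemma sigma6_pow_six (μ : Measure (EuclideanSpace ℝ (Fin d))) (i : Fin d) :
    sigma6 μ i ^ 6 = ∫ y, y i ^ 6 ∂μ := by
  rw [sigma6, ← Real.rpow_natCast, ← Real.rpow_mul (integral_nonneg fun y => by positivity)]
  norm_num

lemma sigma6_le_momentM (hμ : Integrable (fun y => l6NormPow y) μ) (i : Fin d) :
    sigma6 μ i ≤ momentM μ := by
  refine Real.rpow_le_rpow (integral_nonneg fun y => by positivity) ?_ (by norm_num)
  refine integral_mono (integrable_coord_pow_six hμ i) hμ fun y => ?_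
  rw [← Even.pow_abs (by decide)]
  exact Finset.single_le_sum (f := fun i => |y i| ^ 6) (fun i _ => by positivity)
    (Finset.mem_univ i)

/-- Each of the `d` rescaled coordinates has sixth moment one. -/
lemma lintegral_scaledPow_sigma6_le (hμ : Integrable (fun y => l6NormPow y) μ)
    (hσ : ∀ i, 0 < sigma6 μ i) :
    ∫⁻ y, ENNReal.ofReal (scaledPow (sigma6 μ) y) ∂μ ≤ d := by
  have hi : ∀ i, Integrable (fun y : EuclideanSpace ℝ (Fin d) => (y i / sigma6 μ i) ^ 6) μ := by
    intro i
    simp_rw [div_pow]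
    exact (integrable_coord_pow_six hμ i).div_const _
  rw [← ofReal_integral_eq_lintegral_ofReal (f := scaledPow (sigma6 μ))
    (integrable_finsetSum _ fun i _ => hi i)
    (Eventually.of_forall fun y => scaledPow_nonneg _ y)]
  unfold scaledPow
  rw [integral_finsetSum _ fun i _ => hi i]
  have : ∀ i, ∫ y : EuclideanSpace ℝ (Fin d), (y i / sigma6 μ i) ^ 6 ∂μ = 1 := by
    intro i
    simp_rw [div_pow]
    rw [integral_div, ← sigma6_pow_six, div_self (pow_pos (hσ i) 6).ne']
  simp [this]

end Moments

/-! ### Normalisation by the first scale, and conclusion. -/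

/-- By homogeneity, pulling `s 0 ^ d` out of the product produces the factor `s 0 ^ 2 ≤ M ^ 2`. -/
lemma rpow_div_prod_le {d : ℕ} [NeZero d] {s : Fin d → ℝ} (hs : ∀ i, 0 < s i) {M : ℝ}
    (hM : s 0 ≤ M) (N : ℕ) :
    ((N : ℝ) / ∏ i, s i) ^ (-(2 / (d : ℝ))) ≤
      M ^ 2 * ((N : ℝ) / ∏ i, (s i / s 0)) ^ (-(2 / (d : ℝ))) := by
  have hT : 0 < ∏ i, s i := Finset.prod_pos fun i _ => hs i
  have hd0 : (d : ℝ) ≠ 0 := by exact_mod_cast NeZero.ne d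
  have h0 := hs 0
  have hprod : (N : ℝ) / ∏ i, (s i / s 0) = N / (∏ i, s i) * s 0 ^ d := by
    rw [Finset.prod_div_distrib, Finset.prod_const, Finset.card_univ, Fintype.card_fin]
    field_simp
  have hpow : (s 0 ^ d) ^ (-(2 / (d : ℝ))) = (s 0 ^ 2)⁻¹ := by
    rw [← Real.rpow_natCast, ← Real.rpow_mul h0.le,
      show (d : ℝ) * -(2 / (d : ℝ)) = -((2 : ℕ) : ℝ) by push_cast; field_simp,
      Real.rpow_neg h0.le, Real.rpow_natCast]
  rw [hprod, Real.mul_rpow (by positivity) (by positivity), hpow]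
  set R := ((N : ℝ) / ∏ i, s i) ^ (-(2 / (d : ℝ)))
  have hR : 0 ≤ R := by positivity
  calc R = s 0 ^ 2 * (R * (s 0 ^ 2)⁻¹) := by field_simp
    _ ≤ M ^ 2 * (R * (s 0 ^ 2)⁻¹) := by gcongr

theorem theorem2p2 (d : ℕ) [NeZero d] :
    ∃ C : ℝ, 0 < C ∧
      ∀ (μ : Measure (EuclideanSpace ℝ (Fin d))) [IsProbabilityMeasure μ],
        Integrable (fun y => l6NormPow y) μ →
        Antitone (sigma6 μ) → (∀ i, 0 < sigma6 μ i) →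
        ∀ᶠ N : ℕ in atTop,
          ∀ (Ω : Type*) [MeasurableSpace Ω] (P : Measure Ω) [IsProbabilityMeasure P]
            (Y : Fin N → Ω → EuclideanSpace ℝ (Fin d)),
            (∀ i, HasLaw (Y i) μ P) → iIndepFun Y P →
            ∫⁻ ω, W2 (empiricalMeasure fun i => Y i ω) μ ^ 2 ∂P ≤
              ENNReal.ofReal (C * momentM μ ^ 2 * w2Rate (sigma6 μ) N) := by
  refine ⟨rateConst d, rateConst_pos d, ?_⟩
  intro μ _ hμ _ hσ
  -- The smallest `σ_i` is the coarsest grid side for which the cube count is valid.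
  obtain ⟨i₀, -, hi₀⟩ := Finset.exists_min_image Finset.univ (sigma6 μ) Finset.univ_nonempty
  have hδ : 0 < sigma6 μ i₀ := hσ i₀
  have hδs : ∀ i, sigma6 μ i₀ ≤ sigma6 μ i := fun i => hi₀ i (Finset.mem_univ i)
  have hM : ∀ i, sigma6 μ i ≤ momentM μ := sigma6_le_momentM hμ
  rcases le_or_gt d 4 with hd | hd
  · filter_upwards [eventually_multiscale_le_of_le_four hd hδ hδs (hM i₀) hM,
      eventually_ge_atTop 1] with N hN hN1 Ω _ P _ Y hY hI
    obtain ⟨K, ε, hε, hK, hle⟩ := hN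
    refine (lintegral_W2_sq_le (by omega) hY hI hε K (fun i => hK.trans_le (hδs i))
      (lintegral_scaledPow_sigma6_le hμ hσ)).trans (ENNReal.ofReal_le_ofReal (hle.trans ?_))
    rw [w2Rate, if_pos hd]
  · filter_upwards [eventually_multiscale_le_of_four_lt hd hδ hδs,
      eventually_ge_atTop 1] with N hN hN1 Ω _ P _ Y hY hI
    obtain ⟨K, ε, hε, hK, hle⟩ := hN
    refine (lintegral_W2_sq_le (by omega) hY hI hε K (fun i => hK.trans_le (hδs i))
      (lintegral_scaledPow_sigma6_le hμ hσ)).trans (ENNReal.ofReal_le_ofReal (hle.trans ?_))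
    rw [w2Rate, if_neg (not_le.2 hd), mul_assoc]
    refine mul_le_mul_of_nonneg_left ?_ (rateConst_pos d).le
    have h := rpow_div_prod_le hσ (hM 0) N
    -- For large `N` the second term of the rate suffices; `N^{-1/2}` is only added.
    exact h.trans (mul_le_mul_of_nonneg_left
      (le_add_of_nonneg_left (Real.rpow_nonneg (Nat.cast_nonneg N) _)) (sq_nonneg _))
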